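/- \textbf{Theorem 3.} Let $G$ be a graph and let a fire break out at a vertex $v$ at time $0$. In each turn $t=1,2,\dots$ the firefighter first protects one vertex that is not on fire (or, in a turn where extra protections are allowed, correspondingly more), and then the fire spreads to all unprotected neighbours of the burning vertices; burning and protected vertices stay so forever. A vertex is saved by a strategy $\mathcal F$ if it never catches fire; let $S(\mathcal F)$ be the set of saved vertices and $N_{\le i}(v)$ the set of vertices at distance at most $i$ from $v$. Put $$\rho_{\mathcal F}(G,v)=\liminf_{i\to\infty}\frac{|N_{\le i}(v)\cap S(\mathcal F)|}{|N_{\le i}(v)|},\qquad \rho(G,v)=\sup_{\mathcal F}\rho_{\mathcal F}(G,v),$$ where the supremum is over all strategies that protect one vertex per turn. Let $G_{hex}$ be the infinite hexagonal grid, and let $v$ be any vertex of it (since $G_{hex}$ is vertex-transitive, $\rho(G_{hex})=\rho(G_{hex},v)$ does not depend on $v$). (i) $\rho(G_{hex})\ge 2/3$; moreover, there is a strategy $\mathcal F$ protecting one vertex per turn with $\rho_{\mathcal F}(G_{hex},v)\ge 2/3$. (ii) There is a strategy with the following property. Whenever $1\le t_1\le t_2$ are integers (possibly $t_1=t_2$)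 and, besides one vertex in every turn, the firefighter is allowed to protect one extra vertex in turn $t_1$ and one extra vertex in turn $t_2$, the strategy contains the fire, that is, after finitely many turns every neighbour of a burning vertex is burning or protected. The strategy does not need to know $t_1$ and $t_2$ in advance: what it protects in turn $t$ depends only on the numbers of vertices that it was allowed to protect in the turns $1,\dots,t$. -/

import Mathlib

open Filter

noncomputable section

/-! ### The firefighter game on a graph

A fire breaks out at `v` at time `0`.  In each turn `t = 1, 2, …` first the vertices of the finite
set `P t` are protected, and then the fire spreads to all unprotected neighbours of the burning
vertices.  The value `P 0` plays no role. -/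

/-- The vertices protected in the turns `1, …, t`. -/
def protectedBy {V : Type*} (P : ℕ → Finset V) (t : ℕ) : Set V :=
  {x | ∃ s, 1 ≤ s ∧ s ≤ t ∧ x ∈ P s}

/-- The vertices on fire after turn `t`. -/
def burning {V : Type*} (G : SimpleGraph V) (v : V) (P : ℕ → Finset V) : ℕ → Set V
  | 0 => {v}
  | t + 1 => burning G v P t ∪
      {x | x ∉ protectedBy P (t + 1) ∧ ∃ u ∈ burning G v P t, G.Adj u x}

/-- The play `P` is legal if in each turn `t ≥ 1` at most `a t` vertices are protected, none of
which is on fire at that moment. -/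
def IsLegal {V : Type*} (G : SimpleGraph V) (v : V) (a : ℕ → ℕ) (P : ℕ → Finset V) : Prop :=
  ∀ t, (P (t + 1)).card ≤ a (t + 1) ∧ ∀ x ∈ P (t + 1), x ∉ burning G v P t

/-- The fire is contained: at some time every neighbour of a burning vertex is on fire or
protected, so that the fire cannot spread any more. -/
def IsContained {V : Type*} (G : SimpleGraph V) (v : V) (P : ℕ → Finset V) : Prop :=
  ∃ T, ∀ u ∈ burning G v P T, ∀ w, G.Adj u w → w ∈ burning G v P T ∨ w ∈ protectedBy P T

/-- The vertices that never catch fire. -/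
def savedSet {V : Type*} (G : SimpleGraph V) (v : V) (P : ℕ → Finset V) : Set V :=
  {x | ∀ t, x ∉ burning G v P t}

/-- The vertices at distance at most `i` from `v`. -/
def graphBall {V : Type*} (G : SimpleGraph V) (v : V) (i : ℕ) : Set V :=
  {x | G.edist v x ≤ (i : ℕ∞)}

/-- The surviving rate of the play `P` when the fire breaks out at `v`: the lower limit of the
proportion of saved vertices in the balls around `v`. -/
def playSurvivingRate {V : Type*} (G : SimpleGraph V) (v : V) (P : ℕ → Finset V) : ℝ :=
  liminf (fun i : ℕ => ((graphBall G v i ∩ savedSet G v P).ncard : ℝ) / ((graphBall G v i).ncard : ℝ))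
    atTop

/-- The optimal surviving rate of `G` for one firefighter when the fire breaks out at `v`.
All quotients above lie in `[0, 1]`, so the supremum is over a bounded nonempty set. -/
def survivingRate {V : Type*} (G : SimpleGraph V) (v : V) : ℝ :=
  sSup {r | ∃ P : ℕ → Finset V, IsLegal G v (fun _ => 1) P ∧ r = playSurvivingRate G v P}

/-! ### Strategies without knowledge of the future -/

/-- An online strategy: given the list of the numbers of vertices that may be protected in the
turns `1, …, t`, it returns the set of vertices to protect in turn `t`.  (The fire spreads
deterministically, so this list determines the whole past of the game.) -/
abbrev OnlineStrategy (V : Type*) := List ℕ → Finset V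

/-- The play resulting from the strategy `σ` if `a t` vertices may be protected in turn `t`. -/
def OnlineStrategy.play {V : Type*} (σ : OnlineStrategy V) (a : ℕ → ℕ) : ℕ → Finset V :=
  fun t => σ ((List.range t).map fun i => a (i + 1))

/-- One vertex in every turn, and one extra vertex at each of the times `t₁` and `t₂`
(two extra vertices if `t₁ = t₂`). -/
def extraAllowance (t₁ t₂ : ℕ) : ℕ → ℕ :=
  fun t => 1 + (if t = t₁ then 1 else 0) + (if t = t₂ then 1 else 0)

/-! ### The infinite hexagonal grid -/

/-- With `e₁ = √3/2 - i/2` and `e₂ = √3/2 + i/2` in the complex plane, `(a, b, false)` is the point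
`a e₁ + b e₂` of the triangular lattice, and `(a, b, true)` is the point `a e₁ + b e₂ + 1/√3`. -/
abbrev HexVertex := ℤ × ℤ × Bool

/-- `(a, b, false)` is joined to `(a, b, true)`, `(a - 1, b, true)` and `(a, b - 1, true)`, which
are the points at distance `1/√3` from it; there are no other edges. -/
def hexLink (p q : HexVertex) : Prop :=
  p.2.2 = false ∧ q.2.2 = true ∧
    ((q.1 = p.1 ∧ q.2.1 = p.2.1) ∨ (q.1 = p.1 - 1 ∧ q.2.1 = p.2.1) ∨
      (q.1 = p.1 ∧ q.2.1 = p.2.1 - 1))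

/-- The infinite hexagonal grid. -/
def hexGrid : SimpleGraph HexVertex where
  Adj p q := hexLink p q ∨ hexLink q p
  symm := ⟨fun _ _ h => h.symm⟩
  loopless := ⟨fun p h => by
    rcases h with h | h <;> exact Bool.noConfusion (h.1.symm.trans h.2.1)⟩

end

/-! Two walls in the lattice directions (-1, 0) and (0, 1), extended alternately by one vertex per
turn, keep pace exactly with the fire and confine it to a wedge of angle 2π/3. A ball of radius i
has at least 6m² vertices, where m = ⌊i/2⌋, and at most 2(m+2)² of them lie in the wedge. Hence in
the limit at least 2/3 is saved.

The wedge leaves no turn to spare. One extra vertex in turn n = t₁ puts everything later one turn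
ahead, just enough to bend the walls into the parallel sides of a strip in direction (-1, 1): a unit
of strip costs the fire two turns and the firefighter two vertices. One side (the slit) stops after
12n units. From then on all vertices go to the other side, which outruns the fire, rounds the tip of
the slit and closes up with its origin in time. Before turn n the play does not depend on n, so no
foresight is needed.

The timing is certified by potentials (`wedgeTime`, `arrivalTime`) that grow by at most one along
every edge open to the fire, see `burning_subset_of_certificate`. -/

open Topology

/-! ### Certificates for the spread of the fire, and transport along automorphisms. -/

section Transport

variable {V : Type*} {G : SimpleGraph V}

/-- The fire stays in `R`, and it reaches `x` no earlier than at time `f x`, if every edge leaving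
`R` or increasing `f` by more than one ends in a vertex that is protected in time. -/
theorem burning_subset_of_certificate {v : V} {P : ℕ → Finset V} (R : Set V) (f : V → ℤ)
    (hv : v ∈ R) (hfv : f v ≤ 0)
    (h : ∀ u ∈ R, ∀ w, G.Adj u w →
      (w ∈ R ∧ f w ≤ f u + 1) ∨ ∃ s : ℕ, 1 ≤ s ∧ (s : ℤ) ≤ f u + 1 ∧ w ∈ P s) (t : ℕ) :
    ∀ x ∈ burning G v P t, x ∈ R ∧ f x ≤ t := by
  induction t with
  | zero =>
    rintro x rfl
    exact ⟨hv, by simpa using hfv⟩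
  | succ t ih =>
    rintro x (hx | ⟨hx, u, hu, hux⟩)
    · have := ih x hx
      exact ⟨this.1, by push_cast; linarith [this.2]⟩
    · obtain ⟨huR, hfu⟩ := ih u hu
      rcases h u huR x hux with ⟨hxR, hfx⟩ | ⟨s, hs, hsf, hxs⟩
      · exact ⟨hxR, by push_cast; linarith⟩
      · exact absurd ⟨s, hs, by zify; linarith, hxs⟩ hx

theorem burning_mono (v : V) (P : ℕ → Finset V) : Monotone (burning G v P) :=
  monotone_nat_of_le_succ fun _ => Set.subset_union_left

/-- A fire that stays in a finite set is contained. -/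
theorem isContained_of_burning_subset_finite {v : V} {P : ℕ → Finset V} {R : Set V}
    (hR : R.Finite) (h : ∀ t, burning G v P t ⊆ R) : IsContained G v P := by
  have hex : ∃ t, burning G v P (t + 1) = burning G v P t := by
    by_contra! hne
    have hlt : StrictMono fun t => (burning G v P t).ncard := by
      refine strictMono_nat_of_lt_succ fun t => Set.ncard_lt_ncard ?_ (hR.subset (h _))
      exact lt_of_le_of_ne (burning_mono v P t.le_succ) (hne t).symm
    have h1 := hlt.le_apply (x := R.ncard + 1)
    have h2 := Set.ncard_le_ncard (h (R.ncard + 1)) hR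
    omega
  obtain ⟨t, ht⟩ := hex
  -- Time t would not do: a neighbour escaping the fire in turn t + 1 may have been protected only
  -- in that turn.
  refine ⟨t + 1, fun u hu w huw => ?_⟩
  by_cases hw : w ∈ protectedBy P (t + 1)
  · exact Or.inr hw
  · exact Or.inl (Or.inr ⟨hw, u, ht ▸ hu, huw⟩)

variable (e : G ≃g G)

/-- The image of a play under an automorphism. -/
def mapPlay (P : ℕ → Finset V) : ℕ → Finset V := fun t => (P t).map e.toEquiv.toEmbedding

theorem mem_mapPlay {P : ℕ → Finset V} {t : ℕ} {x : V} : e x ∈ mapPlay e P t ↔ x ∈ P t :=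
  Finset.mem_map' e.toEquiv.toEmbedding

theorem apply_mem_protectedBy_mapPlay {P : ℕ → Finset V} {t : ℕ} {x : V} :
    e x ∈ protectedBy (mapPlay e P) t ↔ x ∈ protectedBy P t := by
  simp [protectedBy, mem_mapPlay]

theorem apply_mem_burning_mapPlay {v : V} {P : ℕ → Finset V} {t : ℕ} {x : V} :
    e x ∈ burning G (e v) (mapPlay e P) t ↔ x ∈ burning G v P t := by
  induction t generalizing x with
  | zero => simp [burning]
  | succ t ih =>
    simp only [burning, Set.mem_union, ih, Set.mem_ofPred_eq, apply_mem_protectedBy_mapPlay]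
    refine or_congr_right (and_congr_right fun _ => ?_)
    rw [← e.surjective.exists.symm]
    simp [ih, e.map_adj_iff]

theorem IsLegal.mapPlay {v : V} {a : ℕ → ℕ} {P : ℕ → Finset V} (h : IsLegal G v a P) :
    IsLegal G (e v) a (mapPlay e P) := by
  refine fun t => ⟨by simpa [_root_.mapPlay] using (h t).1, fun x hx => ?_⟩
  obtain ⟨x, rfl⟩ := e.surjective x
  rw [apply_mem_burning_mapPlay]
  exact (h t).2 x ((mem_mapPlay e).1 hx)

theorem IsContained.mapPlay {v : V} {P : ℕ → Finset V} (h : IsContained G v P) :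
    IsContained G (e v) (mapPlay e P) := by
  obtain ⟨T, hT⟩ := h
  refine ⟨T, fun u hu w huw => ?_⟩
  obtain ⟨u, rfl⟩ := e.surjective u
  obtain ⟨w, rfl⟩ := e.surjective w
  rw [apply_mem_burning_mapPlay] at hu ⊢
  rw [apply_mem_protectedBy_mapPlay]
  exact hT u hu w (e.map_adj_iff.1 huw)

theorem savedSet_mapPlay (v : V) (P : ℕ → Finset V) :
    savedSet G (e v) (mapPlay e P) = e '' savedSet G v P := by
  ext x
  obtain ⟨x, rfl⟩ := e.surjective x
  rw [e.injective.mem_set_image]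
  simp [savedSet, apply_mem_burning_mapPlay]

theorem edist_apply_le (e : G ≃g G) (v x : V) : G.edist (e v) (e x) ≤ G.edist v x := by
  by_cases h : G.edist v x = ⊤
  · simp [h]
  · obtain ⟨p, hp⟩ := SimpleGraph.exists_walk_of_edist_ne_top h
    rw [← hp]
    simpa using SimpleGraph.edist_le (p.map e.toHom)

theorem graphBall_apply (v : V) (i : ℕ) : graphBall G (e v) i = e '' graphBall G v i := by
  ext x
  obtain ⟨x, rfl⟩ := e.surjective x
  rw [e.injective.mem_set_image]
  have h : G.edist (e v) (e x) = G.edist v x :=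
    le_antisymm (edist_apply_le e v x) (by simpa using edist_apply_le e.symm (e v) (e x))
  simp [graphBall, h]

theorem playSurvivingRate_mapPlay (v : V) (P : ℕ → Finset V) :
    playSurvivingRate G (e v) (mapPlay e P) = playSurvivingRate G v P := by
  simp only [playSurvivingRate, savedSet_mapPlay, graphBall_apply,
    ← Set.image_inter e.injective, Set.ncard_image_of_injective _ e.injective]

end Transport

/-! ### Adjacency and symmetries of the hexagonal grid. -/

theorem hexGrid_adj_false {a b : ℤ} {w : HexVertex} : hexGrid.Adj (a, b, false) w ↔
    w = (a, b, true) ∨ w = (a - 1, b, true) ∨ w = (a, b - 1, true) := by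
  obtain ⟨c, d, _ | _⟩ := w <;> simp [hexGrid, hexLink]

theorem hexGrid_adj_true {a b : ℤ} {w : HexVertex} : hexGrid.Adj (a, b, true) w ↔
    w = (a, b, false) ∨ w = (a + 1, b, false) ∨ w = (a, b + 1, false) := by
  obtain ⟨c, d, _ | _⟩ := w <;> simp [hexGrid, hexLink]
  all_goals omega

/-- The hexagonal grid is vertex-transitive. -/
theorem exists_hexGrid_iso (v : HexVertex) : ∃ e : hexGrid ≃g hexGrid, e (0, 0, false) = v := by
  obtain ⟨a, b, _ | _⟩ := v
  · refine ⟨⟨⟨fun x => (x.1 + a, x.2.1 + b, x.2.2), fun x => (x.1 - a, x.2.1 - b, x.2.2),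
      fun x => by simp, fun x => by simp⟩, ?_⟩, ?_⟩
    · rintro ⟨x, y, _ | _⟩ ⟨z, w, _ | _⟩ <;> simp [hexGrid, hexLink] <;> omega
    · change ((0 : ℤ) + a, (0 : ℤ) + b, false) = _
      simp
  -- A point reflection exchanges the two vertex classes.
  · refine ⟨⟨⟨fun x => (a - x.1, b - x.2.1, !x.2.2), fun x => (a - x.1, b - x.2.1, !x.2.2),
      fun x => by simp, fun x => by simp⟩, ?_⟩, ?_⟩
    · rintro ⟨x, y, _ | _⟩ ⟨z, w, _ | _⟩ <;> simp [hexGrid, hexLink] <;> omega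
    · change (a - (0 : ℤ), b - (0 : ℤ), !false) = _
      simp

/-! ### The containing barrier and its potentials. -/

/-- The vertices of the barrier in the order in which they are protected.  It starts with the two
sides of a wedge of angle `2π/3`, continues with the two sides of a strip, and then leads one side
of the strip around the tip of the other one, back to its origin. -/
def barrier (n k : ℕ) : HexVertex :=
  if k ≤ 2 * n + 1 then
    if k % 2 = 1 then (-(k / 2 : ℤ), -1, true) else (1, k / 2 - 1, false)
  else if k < 28 * n + 2 then
    if k % 2 = 1 then (-(n + 1 + (k - 2 * n - 2) / 2 : ℤ), (k - 2 * n - 2) / 2, false)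
    else if k < 26 * n + 2 then (-((k - 2 * n - 2) / 2 : ℤ), n + (k - 2 * n - 2) / 2, true)
    else (-(14 * n + 1 : ℤ), n + (k - 2 * n - 2) / 2, true)
  else if k < 30 * n + 3 then (-(14 * n + 1 : ℤ), k - 14 * n - 2, true)
  else if k < 35 * n + 4 then (k - 44 * n - 3, 16 * n + 1, false)
  else if k < 44 * n + 4 then (k - 44 * n - 3, 51 * n + 4 - k, true)
  else (1, k - 43 * n - 3, false)

/-- The `k`-th vertex of the barrier, as long as there is one. -/
def barrierFinset (n k : ℕ) : Finset HexVertex :=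
  if k ≤ 50 * n + 3 then {barrier n k} else ∅

/-- One vertex of the barrier in each turn, and two in turn `n`. -/
def containingPlay (n t : ℕ) : Finset HexVertex :=
  (if t ≤ n then barrierFinset n t else ∅) ∪ (if n ≤ t then barrierFinset n (t + 1) else ∅)

/-- The region enclosed by the barrier. -/
def enclosedRegion (n : ℕ) : Set HexVertex :=
  {x | -(14 * n) ≤ x.1 ∧ x.1 ≤ 0 ∧ 0 ≤ x.2.1 ∧ x.2.1 ≤ 16 * n ∧
    if x.2.2 then -(n + 1) ≤ x.1 + x.2.1 ∧ x.1 + x.2.1 ≤ 7 * n ∧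
      -- Every path from a + b ≤ n to a + b > n passes a `true` vertex with a + b = n, so removing
      -- these makes the slit.
      (x.1 + x.2.1 = n → x.1 ≤ -(12 * n))
    else -n ≤ x.1 + x.2.1 ∧ x.1 + x.2.1 ≤ 7 * n + 1}

/-- A lower bound for the distance from `(0, 0, false)` in the quadrant `x.1 ≤ 0 ≤ x.2.1`. -/
def wedgeTime (x : HexVertex) : ℤ :=
  if x.2.2 then max (-2 * x.1 - 1) (2 * x.2.1 + 1) else max (-2 * x.1) (2 * x.2.1)

/-- A lower bound for the time at which the fire arrives at a vertex of the enclosed region. -/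
def arrivalTime (n : ℕ) (x : HexVertex) : ℤ :=
  -- Behind the slit the fire has come around the tip near (-12n, 13n), where both expressions for
  -- `false` vertices equal 26n.
  if n < x.1 + x.2.1 ∧ -(12 * n) < x.1 then
    if x.2.2 then max (2 * (x.1 + x.2.1) + 1 + 24 * n) (50 * n + 2 * x.1 + 1)
    else max (2 * (x.1 + x.2.1) + 24 * n) (50 * n + 2 * x.1)
  else wedgeTime x

theorem card_barrierFinset_le (n k : ℕ) : (barrierFinset n k).card ≤ 1 := by
  unfold barrierFinset
  split_ifs <;> simp

theorem card_containingPlay_le (n t : ℕ) :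
    (containingPlay n t).card ≤ if t = n then 2 else 1 := by
  have h1 := card_barrierFinset_le n t
  have h2 := card_barrierFinset_le n (t + 1)
  unfold containingPlay
  refine (Finset.card_union_le _ _).trans ?_
  split_ifs <;> first | omega | (rw [Finset.card_empty]; omega)

/-- The second alternative of `hd` is the one-turn lead gained in turn n. -/
theorem exists_turn_of_eq_barrier {n : ℕ} (hn : 1 ≤ n) {x : HexVertex} {d : ℤ} (k : ℕ)
    (hk : 1 ≤ k) (hk' : k ≤ 50 * n + 3) (hx : x = barrier n k)
    (hd : k ≤ d ∨ n < k ∧ k ≤ d + 1) :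
    ∃ s : ℕ, 1 ≤ s ∧ (s : ℤ) ≤ d ∧ x ∈ containingPlay n s := by
  by_cases h : k ≤ n
  · refine ⟨k, hk, by omega, ?_⟩
    simp [containingPlay, barrierFinset, h, hk', hx]
  · refine ⟨k - 1, by omega, by omega, ?_⟩
    have h1 : k - 1 + 1 = k := by omega
    have h2 : n ≤ k - 1 := by omega
    simp [containingPlay, barrierFinset, h1, h2, hk', hx]

theorem exists_eq_barrier_of_mem_containingPlay {n t : ℕ} {x : HexVertex}
    (hx : x ∈ containingPlay n t) : ∃ k, x = barrier n k := by
  simp only [containingPlay, barrierFinset, Finset.mem_union] at hx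
  rcases hx with hx | hx
  · split_ifs at hx <;> simp at hx
    exact ⟨t, hx⟩
  · split_ifs at hx <;> simp at hx
    exact ⟨t + 1, hx⟩

/-- This yields legality: the fire never leaves the region, so no barrier vertex ever burns. -/
theorem barrier_notMem_enclosedRegion (n k : ℕ) :
    barrier n k ∉ enclosedRegion n := by
  unfold barrier enclosedRegion
  split_ifs <;> simp <;> omega

theorem enclosedRegion_finite (n : ℕ) : (enclosedRegion n).Finite := by
  refine ((Set.finite_Icc (-(14 * n) : ℤ) 0).prod
    ((Set.finite_Icc (0 : ℤ) (16 * n)).prod Set.finite_univ)).subset ?_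
  rintro x ⟨h1, h2, h3, h4, -⟩
  exact ⟨⟨h1, h2⟩, ⟨h3, h4⟩, trivial⟩

/-! ### Every edge of the region respects the potential or ends in a wall built in time. -/

section Edges

variable {n : ℕ} {a b : ℤ}

theorem barrier_left_wedge (ha : -n ≤ a) (ha' : a ≤ 0) :
    (a, -1, true) = barrier n (1 - 2 * a).toNat := by
  rw [barrier, if_pos (by omega), if_pos (by omega)]
  ext <;> simp; omega

theorem barrier_right_wedge (hb : 0 ≤ b) (hb' : b < n) :
    (1, b, false) = barrier n (2 * b + 2).toNat := by
  rw [barrier, if_pos (by omega), if_neg (by omega)]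
  ext <;> simp; omega

theorem barrier_slit (ha : -(12 * n) < a) (ha' : a ≤ 0) (hab : a + b = n) :
    (a, b, true) = barrier n (2 * n + 2 - 2 * a).toNat := by
  rw [barrier, if_neg (by omega), if_pos (by omega), if_neg (by omega), if_pos (by omega)]
  ext <;> simp <;> omega

theorem barrier_left_strip (hb : 0 ≤ b) (hb' : b < 13 * n) (hab : a + b = -(n + 1)) :
    (a, b, false) = barrier n (2 * n + 3 + 2 * b).toNat := by
  rw [barrier, if_neg (by omega), if_pos (by omega), if_pos (by omega)]
  ext <;> simp <;> omega

theorem barrier_top (hb : 13 * n ≤ b) (hb' : b ≤ 16 * n) (ha : a = -(14 * n + 1)) :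
    (a, b, true) =
      barrier n (if b < 14 * n then 2 * b + 2 else b + 14 * n + 2).toNat := by
  split_ifs
  · rw [barrier, if_neg (by omega), if_pos (by omega), if_neg (by omega), if_neg (by omega)]
    ext <;> simp <;> omega
  · rw [barrier, if_neg (by omega), if_neg (by omega), if_pos (by omega)]
    ext <;> simp <;> omega

theorem barrier_right (ha : -(14 * n) ≤ a) (ha' : a ≤ -(9 * n)) (hb : b = 16 * n + 1) :
    (a, b, false) = barrier n (44 * n + 3 + a).toNat := by
  rw [barrier, if_neg (by omega), if_neg (by omega), if_neg (by omega), if_pos (by omega)]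
  ext <;> simp <;> omega

theorem barrier_diagonal (ha : -(9 * n) < a) (ha' : a ≤ 0) (hab : a + b = 7 * n + 1) :
    (a, b, true) = barrier n (44 * n + 3 + a).toNat := by
  rw [barrier, if_neg (by omega), if_neg (by omega), if_neg (by omega), if_neg (by omega),
    if_pos (by omega)]
  ext <;> simp <;> omega

theorem barrier_bottom (hb : n < b) (hb' : b ≤ 7 * n) :
    (1, b, false) = barrier n (43 * n + 3 + b).toNat := by
  rw [barrier, if_neg (by omega), if_neg (by omega), if_neg (by omega), if_neg (by omega),
    if_neg (by omega)]
  ext <;> simp; omega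


/-- The shape of the barrier is fitted to these inequalities. For instance, on the wall a = -(14n +
1) with b ≥ 14n the condition is b + 14n + 1 ≤ 2b + 1, sharp at b = 14n. -/
theorem enclosedRegion_edge_of_false (hn : 1 ≤ n) (hu : (a, b, false) ∈ enclosedRegion n)
    {w : HexVertex} (h : hexGrid.Adj (a, b, false) w) :
    (w ∈ enclosedRegion n ∧ arrivalTime n w ≤ arrivalTime n (a, b, false) + 1) ∨
      ∃ s : ℕ, 1 ≤ s ∧ (s : ℤ) ≤ arrivalTime n (a, b, false) + 1 ∧ w ∈ containingPlay n s := by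
  obtain ⟨h1, h2, h3, h4, h5⟩ := hu
  simp only [Bool.false_eq_true, if_false] at h1 h2 h3 h4 h5
  have hwall {c d : ℤ} (k : ℤ) (hk : 1 ≤ k) (hk' : k ≤ 50 * n + 3)
      (hx : (c, d, true) = barrier n k.toNat)
      (hd : k ≤ arrivalTime n (a, b, false) + 1 ∨
        n < k ∧ k ≤ arrivalTime n (a, b, false) + 1 + 1) :
      ∃ s : ℕ, 1 ≤ s ∧ (s : ℤ) ≤ arrivalTime n (a, b, false) + 1 ∧
        (c, d, true) ∈ containingPlay n s :=
    exists_turn_of_eq_barrier hn k.toNat (by omega) (by omega) hx (by omega)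
  -- From the strip the slit is met just in time. From behind it is met after time 26n, when it is
  -- complete.
  have hslit {c d : ℤ} (hc : -(12 * n) < c) (hc' : c ≤ 0) (hcd : c + d = n)
      (h : (c = a ∧ d = b) ∨ (c = a - 1 ∧ d = b) ∨ (c = a ∧ d = b - 1)) :=
    hwall (c := c) (d := d) _ (by omega) (by omega) (barrier_slit hc hc' hcd) (by
      simp only [arrivalTime, wedgeTime, Bool.false_eq_true, if_false]
      split_ifs <;> omega)
  rcases hexGrid_adj_false.1 h with rfl | rfl | rfl
  · by_cases hs : a + b = n ∧ -(12 * n) < a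
    · exact Or.inr (hslit hs.2 h2 hs.1 (by omega))
    by_cases hd : a + b = 7 * n + 1
    · refine Or.inr (hwall _ ?_ ?_ (barrier_diagonal (by omega) h2 hd) ?_)
      · omega
      · omega
      · simp only [arrivalTime, wedgeTime, Bool.false_eq_true, if_false]
        split_ifs <;> omega
    · refine Or.inl ⟨⟨h1, h2, h3, h4, ?_⟩, ?_⟩
      · simp only [if_true]
        omega
      · simp only [arrivalTime, wedgeTime, Bool.false_eq_true, if_false, if_true]
        split_ifs <;> omega
  · by_cases hs : a - 1 + b = n ∧ -(12 * n) < a - 1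
    · exact Or.inr (hslit hs.2 (by omega) hs.1 (by omega))
    by_cases hd : a - 1 = -(14 * n + 1)
    · refine Or.inr (hwall _ ?_ ?_ (barrier_top (by omega) h4 hd) ?_)
      · split_ifs <;> omega
      · split_ifs <;> omega
      · simp only [arrivalTime, wedgeTime, Bool.false_eq_true, if_false]
        split_ifs <;> omega
    · refine Or.inl ⟨⟨?_, ?_, h3, h4, ?_⟩, ?_⟩
      · change _ ≤ a - 1
        omega
      · change a - 1 ≤ _
        omega
      · simp only [if_true]
        omega
      · simp only [arrivalTime, wedgeTime, Bool.false_eq_true, if_false, if_true]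
        split_ifs <;> omega
  · by_cases hs : a + (b - 1) = n ∧ -(12 * n) < a
    · exact Or.inr (hslit hs.2 h2 hs.1 (by omega))
    by_cases hd : b = 0
    · subst hd
      refine Or.inr (hwall _ ?_ ?_ (barrier_left_wedge (by omega) h2) ?_)
      · omega
      · omega
      · simp only [arrivalTime, wedgeTime, Bool.false_eq_true, if_false]
        split_ifs <;> omega
    · refine Or.inl ⟨⟨h1, h2, ?_, ?_, ?_⟩, ?_⟩
      · change _ ≤ b - 1
        omega
      · change b - 1 ≤ _
        omega
      · simp only [if_true]
        omega
      · simp only [arrivalTime, wedgeTime, Bool.false_eq_true, if_false, if_true]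
        split_ifs <;> omega

/-- On the wall b = 16n + 1 the turn 44n + 2 + a is compared with 32n + 2 for a ≤ -12n and with 56n
+ 2a + 2 beyond. Both agree with it at a = -12n. -/
theorem enclosedRegion_edge_of_true (hn : 1 ≤ n) (hu : (a, b, true) ∈ enclosedRegion n)
    {w : HexVertex} (h : hexGrid.Adj (a, b, true) w) :
    (w ∈ enclosedRegion n ∧ arrivalTime n w ≤ arrivalTime n (a, b, true) + 1) ∨
      ∃ s : ℕ, 1 ≤ s ∧ (s : ℤ) ≤ arrivalTime n (a, b, true) + 1 ∧ w ∈ containingPlay n s := by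
  obtain ⟨h1, h2, h3, h4, h5⟩ := hu
  simp only [if_true] at h1 h2 h3 h4 h5
  have hwall {c d : ℤ} (k : ℤ) (hk : 1 ≤ k) (hk' : k ≤ 50 * n + 3)
      (hx : (c, d, false) = barrier n k.toNat)
      (hd : k ≤ arrivalTime n (a, b, true) + 1 ∨
        n < k ∧ k ≤ arrivalTime n (a, b, true) + 1 + 1) :
      ∃ s : ℕ, 1 ≤ s ∧ (s : ℤ) ≤ arrivalTime n (a, b, true) + 1 ∧
        (c, d, false) ∈ containingPlay n s :=
    exists_turn_of_eq_barrier hn k.toNat (by omega) (by omega) hx (by omega)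
  rcases hexGrid_adj_true.1 h with rfl | rfl | rfl
  · by_cases hd : a + b = -(n + 1)
    · refine Or.inr (hwall _ ?_ ?_ (barrier_left_strip h3 (by omega) hd) ?_)
      · omega
      · omega
      · simp only [arrivalTime, wedgeTime, if_true]
        split_ifs <;> omega
    · refine Or.inl ⟨⟨h1, h2, h3, h4, ?_⟩, ?_⟩
      · simp only [Bool.false_eq_true, if_false]
        omega
      · simp only [arrivalTime, wedgeTime, Bool.false_eq_true, if_false, if_true]
        split_ifs <;> omega
  · by_cases hd : a = 0
    · subst hd
      by_cases hb : b < n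
      · refine Or.inr (hwall _ ?_ ?_ (barrier_right_wedge h3 hb) ?_)
        · omega
        · omega
        · simp only [arrivalTime, wedgeTime, if_true]
          split_ifs <;> omega
      · refine Or.inr (hwall _ ?_ ?_ (barrier_bottom (by omega) (by omega)) ?_)
        · omega
        · omega
        · simp only [arrivalTime, wedgeTime, if_true]
          split_ifs <;> omega
    · refine Or.inl ⟨⟨?_, ?_, h3, h4, ?_⟩, ?_⟩
      · change _ ≤ a + 1
        omega
      · change a + 1 ≤ _
        omega
      · simp only [Bool.false_eq_true, if_false]
        omega
      · simp only [arrivalTime, wedgeTime, Bool.false_eq_true, if_false, if_true]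
        split_ifs <;> omega
  · by_cases hd : b = 16 * n
    · refine Or.inr (hwall _ ?_ ?_ (barrier_right h1 (by omega) (by omega)) ?_)
      · omega
      · omega
      · simp only [arrivalTime, wedgeTime, if_true]
        split_ifs <;> omega
    · refine Or.inl ⟨⟨h1, h2, ?_, ?_, ?_⟩, ?_⟩
      · change _ ≤ b + 1
        omega
      · change b + 1 ≤ _
        omega
      · simp only [Bool.false_eq_true, if_false]
        omega
      · simp only [arrivalTime, wedgeTime, Bool.false_eq_true, if_false, if_true]
        split_ifs <;> omega

end Edges

theorem burning_containingPlay_subset {n : ℕ} (hn : 1 ≤ n) (t : ℕ) :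
    burning hexGrid (0, 0, false) (containingPlay n) t ⊆ enclosedRegion n := by
  refine fun x hx => (burning_subset_of_certificate (enclosedRegion n) (arrivalTime n)
    ?_ ?_ ?_ t x hx).1
  · simp [enclosedRegion]
    omega
  · simp [arrivalTime, wedgeTime]
    omega
  · rintro ⟨a, b, _ | _⟩ hu w huw
    · exact enclosedRegion_edge_of_false hn hu huw
    · exact enclosedRegion_edge_of_true hn hu huw

theorem isContained_containingPlay {n : ℕ} (hn : 1 ≤ n) :
    IsContained hexGrid (0, 0, false) (containingPlay n) :=
  isContained_of_burning_subset_finite (enclosedRegion_finite n) (burning_containingPlay_subset hn)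

theorem isLegal_containingPlay {t₁ : ℕ} (h₁ : 1 ≤ t₁) (t₂ : ℕ) :
    IsLegal hexGrid (0, 0, false) (extraAllowance t₁ t₂) (containingPlay t₁) := by
  refine fun t => ⟨(card_containingPlay_le t₁ (t + 1)).trans ?_, fun x hx hb => ?_⟩
  · unfold extraAllowance
    split_ifs <;> omega
  · obtain ⟨k, rfl⟩ := exists_eq_barrier_of_mem_containingPlay hx
    exact barrier_notMem_enclosedRegion t₁ k (burning_containingPlay_subset h₁ t hb)

/-! ### Playing without knowledge of the future. -/

/-- The online strategy that follows `containingPlay n` from the first turn `n` with an extra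
vertex on; up to that turn the plays do not depend on `n`. -/
def containingStrategy : OnlineStrategy HexVertex :=
  fun l => containingPlay (l.findIdx (fun m => m != 1) + 1) l.length

/-- Before the extra vertex only the initial wedge is built, and its formula does not involve n. -/
theorem containingPlay_eq_of_lt {m n t : ℕ} (hm : t < m) (hn : t < n) :
    containingPlay m t = containingPlay n t := by
  have h1 : t ≤ 50 * m + 3 ∧ t ≤ 50 * n + 3 ∧ t ≤ 2 * m + 1 ∧ t ≤ 2 * n + 1 := by omega
  simp [containingPlay, barrierFinset, barrier, hm.le, hn.le, hm.not_ge, hn.not_ge, h1]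

theorem containingStrategy_play {t₁ t₂ : ℕ} (h₁ : 1 ≤ t₁) (h₂ : t₁ ≤ t₂) :
    containingStrategy.play (extraAllowance t₁ t₂) = containingPlay t₁ := by
  funext t
  simp only [OnlineStrategy.play, containingStrategy, List.length_map, List.length_range]
  by_cases ht : t < t₁
  -- With no extra vertex so far, `findIdx` returns the length t, so the strategy plays as if the
  -- extra came in turn t + 1.
  · rw [List.findIdx_eq_length_of_false]
    · simpa using containingPlay_eq_of_lt (Nat.lt_succ_self t) ht
    · simp only [List.mem_map, List.mem_range]
      rintro _ ⟨i, hi, rfl⟩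
      have h1 : i + 1 ≠ t₁ ∧ i + 1 ≠ t₂ := by omega
      simp [extraAllowance, h1]
  · have : List.findIdx (fun m => m != 1)
        ((List.range t).map fun i => extraAllowance t₁ t₂ (i + 1)) = t₁ - 1 := by
      rw [List.findIdx_eq (by simp; omega)]
      constructor
      · simp [extraAllowance, Nat.sub_add_cancel h₁]
        omega
      · intro j hj
        have h1 : j + 1 ≠ t₁ ∧ j + 1 ≠ t₂ := by omega
        simp [extraAllowance, h1]
    rw [this, Nat.sub_add_cancel h₁]

/-! ### The wedge. -/

/-- The play that builds the two sides of a wedge of angle `2π/3`. -/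
def wedgePlay (t : ℕ) : Finset HexVertex :=
  {if t % 2 = 1 then ((-(t / 2 : ℤ), (-1 : ℤ), true) : HexVertex) else (1, t / 2 - 1, false)}

theorem left_mem_wedgePlay {a : ℤ} (ha : a ≤ 0) : (a, -1, true) ∈ wedgePlay (1 - 2 * a).toNat := by
  rw [wedgePlay, if_pos (by omega), Finset.mem_singleton]
  ext <;> simp; omega

theorem right_mem_wedgePlay {b : ℤ} (hb : 0 ≤ b) : (1, b, false) ∈ wedgePlay (2 * b + 2).toNat := by
  rw [wedgePlay, if_neg (by omega), Finset.mem_singleton]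
  ext <;> simp; omega

theorem burning_wedgePlay_subset (t : ℕ) :
    ∀ x ∈ burning hexGrid (0, 0, false) wedgePlay t, x.1 ≤ 0 ∧ 0 ≤ x.2.1 := by
  refine fun x hx => (burning_subset_of_certificate {x : HexVertex | x.1 ≤ 0 ∧ 0 ≤ x.2.1}
    wedgeTime ?_ ?_ ?_ t x hx).1
  · simp
  · simp [wedgeTime]
  · rintro ⟨a, b, _ | _⟩ ⟨ha, hb⟩ w huw <;> dsimp only at ha hb
    · rcases hexGrid_adj_false.1 huw with rfl | rfl | rfl
      · exact Or.inl ⟨⟨ha, hb⟩, by simp [wedgeTime]; omega⟩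
      · refine Or.inl ⟨⟨?_, hb⟩, by simp [wedgeTime]; omega⟩
        change a - 1 ≤ 0
        omega
      · by_cases h : b = 0
        · subst h
          refine Or.inr ⟨(1 - 2 * a).toNat, by omega, ?_, left_mem_wedgePlay ha⟩
          simp [wedgeTime]; omega
        · refine Or.inl ⟨⟨ha, ?_⟩, by simp [wedgeTime]; omega⟩
          change 0 ≤ b - 1
          omega
    · rcases hexGrid_adj_true.1 huw with rfl | rfl | rfl
      · exact Or.inl ⟨⟨ha, hb⟩, by simp [wedgeTime]; omega⟩
      · by_cases h : a = 0
        · subst h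
          refine Or.inr ⟨(2 * b + 2).toNat, by omega, ?_, right_mem_wedgePlay hb⟩
          simp [wedgeTime]; omega
        · refine Or.inl ⟨⟨?_, hb⟩, by simp [wedgeTime]; omega⟩
          change a + 1 ≤ 0
          omega
      · refine Or.inl ⟨⟨ha, ?_⟩, by simp [wedgeTime]; omega⟩
        change 0 ≤ b + 1
        omega

theorem isLegal_wedgePlay : IsLegal hexGrid (0, 0, false) (fun _ => 1) wedgePlay := by
  refine fun t => ⟨by simp [wedgePlay], fun x hx hb => ?_⟩
  have h := burning_wedgePlay_subset t x hb
  rw [wedgePlay, Finset.mem_singleton] at hx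
  subst hx
  split_ifs at h <;> simp at h

/-! ### Balls in the hexagonal grid -/

/-- The distance from `(0, 0, false)`. -/
def hexNorm (x : HexVertex) : ℤ :=
  if x.2.2 then max |2 * x.1 + 1| (max |2 * x.2.1 + 1| |2 * (x.1 + x.2.1) + 1|)
  else max |2 * x.1| (max |2 * x.2.1| |2 * (x.1 + x.2.1)|)

/-- This bounds the distance from below by `hexNorm`; the descent in `exists_adj_hexNorm_lt` gives
the upper bound. -/
theorem hexNorm_le_of_adj {x y : HexVertex} (h : hexGrid.Adj x y) :
    hexNorm y ≤ hexNorm x + 1 := by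
  obtain ⟨a, b, _ | _⟩ := x
  · rcases hexGrid_adj_false.1 h with rfl | rfl | rfl <;> simp [hexNorm] <;> grind
  · rcases hexGrid_adj_true.1 h with rfl | rfl | rfl <;> simp [hexNorm] <;> grind

/-- Up to sign, the three numbers in `hexNorm` sum to 0 or 1, and an edge shifts each by one. Some
edge moves all those of maximal absolute value towards 0. -/
theorem exists_adj_hexNorm_lt {x : HexVertex} (hx : 0 < hexNorm x) :
    ∃ y, hexGrid.Adj y x ∧ hexNorm y < hexNorm x := by
  obtain ⟨a, b, _ | _⟩ := x
  · by_contra! h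
    have h1 := h _ (hexGrid_adj_false.2 (Or.inl rfl)).symm
    have h2 := h _ (hexGrid_adj_false.2 (Or.inr (Or.inl rfl))).symm
    have h3 := h _ (hexGrid_adj_false.2 (Or.inr (Or.inr rfl))).symm
    simp only [hexNorm, Bool.false_eq_true, if_false, if_true, abs_eq_max_neg] at hx h1 h2 h3
    omega
  · by_contra! h
    have h1 := h _ (hexGrid_adj_true.2 (Or.inl rfl)).symm
    have h2 := h _ (hexGrid_adj_true.2 (Or.inr (Or.inl rfl))).symm
    have h3 := h _ (hexGrid_adj_true.2 (Or.inr (Or.inr rfl))).symm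
    simp only [hexNorm, Bool.false_eq_true, if_false, if_true, abs_eq_max_neg] at hx h1 h2 h3
    omega

theorem hexNorm_le_length {x y : HexVertex} (p : hexGrid.Walk x y) :
    hexNorm y ≤ hexNorm x + p.length := by
  induction p with
  | nil => simp
  | cons h p ih =>
    have := hexNorm_le_of_adj h
    push_cast [SimpleGraph.Walk.length_cons]
    linarith

theorem hexNorm_nonneg (x : HexVertex) : 0 ≤ hexNorm x := by
  unfold hexNorm
  split_ifs <;> exact le_max_of_le_left (abs_nonneg _)

theorem edist_le_of_hexNorm_le (i : ℕ) :
    ∀ x : HexVertex, hexNorm x ≤ i → hexGrid.edist (0, 0, false) x ≤ i := by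
  induction i with
  | zero =>
    rintro ⟨a, b, _ | _⟩ h <;> simp only [hexNorm, Bool.false_eq_true, if_false, if_true,
      abs_eq_max_neg] at h
    · obtain rfl : a = 0 := by omega
      obtain rfl : b = 0 := by omega
      simp
    · omega
  | succ i ih =>
    intro x hx
    rcases (hexNorm_nonneg x).eq_or_lt with h0 | h0
    · exact (ih x (by omega)).trans (by exact_mod_cast i.le_succ)
    · obtain ⟨y, hyx, hy⟩ := exists_adj_hexNorm_lt h0
      refine SimpleGraph.edist_triangle.trans
        (add_le_add (ih y (by push_cast at hx; omega))
          (SimpleGraph.edist_eq_one_iff_adj.2 hyx).le) |>.trans ?_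
      simp

theorem mem_graphBall_iff {x : HexVertex} {i : ℕ} :
    x ∈ graphBall hexGrid (0, 0, false) i ↔ hexNorm x ≤ i := by
  refine ⟨fun h => ?_, fun h => edist_le_of_hexNorm_le i x h⟩
  have hi : hexGrid.edist (0, 0, false) x ≤ i := h
  obtain ⟨p, hp⟩ := SimpleGraph.exists_walk_of_edist_ne_top
    (ne_top_of_le_ne_top (ENat.natCast_ne_top i) hi)
  rw [← hp, Nat.cast_le] at hi
  have h0 : hexNorm (0, 0, false) = 0 := by simp [hexNorm]
  have := hexNorm_le_length p
  omega

theorem graphBall_hexGrid_finite (v : HexVertex) (i : ℕ) : (graphBall hexGrid v i).Finite := by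
  obtain ⟨e, rfl⟩ := exists_hexGrid_iso v
  rw [graphBall_apply]
  refine Set.Finite.image _ (((Set.finite_Icc (-(i + 1) : ℤ) (i + 1)).prod
    ((Set.finite_Icc (-(i + 1) : ℤ) (i + 1)).prod Set.finite_univ)).subset ?_)
  rintro ⟨a, b, c⟩ h
  rw [mem_graphBall_iff] at h
  refine ⟨⟨?_, ?_⟩, ⟨?_, ?_⟩, trivial⟩ <;> dsimp only <;>
    rcases c <;> simp only [hexNorm, Bool.false_eq_true, if_false, if_true, abs_eq_max_neg] at h <;>
    omega

/-- The three sectors of angle `2π/3` into which the grid is divided, parametrized for each of the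
two vertex classes by pairs of natural numbers. -/
def sectorPoint : Fin 3 × Bool × ℕ × ℕ → HexVertex
  | (0, false, x, y) => (-y, x + 1, false)
  | (1, false, x, y) => (y - x - 1, -y, false)
  | (2, false, x, y) => (x + 1, y - x - 1, false)
  | (0, true, x, y) => (-(1 + x), y, true)
  | (1, true, x, y) => (x - y, -1 - x, true)
  | (2, true, x, y) => (y, x - y, true)

theorem sectorPoint_injective : Function.Injective sectorPoint := by
  rintro ⟨j, c, x, y⟩ ⟨j', c', x', y'⟩ h
  fin_cases j <;> fin_cases j' <;> cases c <;> cases c' <;> simp [sectorPoint] at h ⊢ <;> omega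

/-- Each sector contributes an m × m rhombus from each vertex class. -/
theorem six_mul_sq_le_ncard_graphBall (m i : ℕ) (hi : 2 * m ≤ i) :
    6 * m ^ 2 ≤ (graphBall hexGrid (0, 0, false) i).ncard := by
  let S : Finset (Fin 3 × Bool × ℕ × ℕ) :=
    Finset.univ ×ˢ Finset.univ ×ˢ Finset.range m ×ˢ Finset.range m
  have hS : (S.image sectorPoint).card = 6 * m ^ 2 := by
    rw [Finset.card_image_of_injective _ sectorPoint_injective]
    simp [S]
    ring
  rw [← hS, ← Set.ncard_coe_finset]
  refine Set.ncard_le_ncard ?_ (graphBall_hexGrid_finite _ i)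
  intro z hz
  obtain ⟨⟨j, c, x, y⟩, h, rfl⟩ := Finset.mem_image.1 (Finset.mem_coe.1 hz)
  simp only [S, Finset.mem_product, Finset.mem_univ, Finset.mem_range, true_and] at h
  rw [mem_graphBall_iff]
  fin_cases j <;> cases c <;>
    simp only [sectorPoint, hexNorm, Bool.false_eq_true, if_false, if_true, abs_eq_max_neg] <;>
    omega

/-- Vertices that burn lie in the wedge, whose part of the ball fits into a box of side ⌊i/2⌋ + 2 in
each vertex class. -/
theorem ncard_graphBall_le_add_saved (i : ℕ) :
    (graphBall hexGrid (0, 0, false) i).ncard ≤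
      (graphBall hexGrid (0, 0, false) i ∩ savedSet hexGrid (0, 0, false) wedgePlay).ncard +
        2 * (i / 2 + 2) ^ 2 := by
  rw [← Set.ncard_inter_add_ncard_sdiff_eq_ncard _ (savedSet hexGrid (0, 0, false) wedgePlay)
    (graphBall_hexGrid_finite _ i)]
  refine Nat.add_le_add_left ?_ _
  let S : Finset HexVertex := Finset.Icc (-(i / 2 + 1 : ℕ) : ℤ) 0 ×ˢ
    Finset.Icc (0 : ℤ) (i / 2 + 1 : ℕ) ×ˢ Finset.univ
  have hS : S.card = 2 * (i / 2 + 2) ^ 2 := by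
    have h1 : ((0 : ℤ) + 1 - -((i / 2 + 1 : ℕ) : ℤ)).toNat = i / 2 + 2 := by omega
    have h2 : (((i / 2 + 1 : ℕ) : ℤ) + 1 - 0).toNat = i / 2 + 2 := by omega
    rw [Finset.card_product, Finset.card_product, Int.card_Icc, Int.card_Icc, h1, h2,
      Finset.card_univ, Fintype.card_bool]
    ring
  rw [← hS, ← Set.ncard_coe_finset]
  refine Set.ncard_le_ncard ?_ S.finite_toSet
  rintro x ⟨hx, hxs⟩
  obtain ⟨t, ht⟩ : ∃ t, x ∈ burning hexGrid (0, 0, false) wedgePlay t := by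
    simpa [savedSet] using hxs
  have h := burning_wedgePlay_subset t x ht
  rw [mem_graphBall_iff] at hx
  obtain ⟨a, b, _ | _⟩ := x <;>
    simp only [hexNorm, Bool.false_eq_true, if_false, if_true, abs_eq_max_neg] at hx h <;>
    simp [S] <;> omega

/-! ### Surviving rates. -/

theorem survivingRatio_le_one (v : HexVertex) (P : ℕ → Finset HexVertex) (i : ℕ) :
    ((graphBall hexGrid v i ∩ savedSet hexGrid v P).ncard : ℝ) / (graphBall hexGrid v i).ncard
      ≤ 1 :=
  div_le_one_of_le₀
    (Nat.cast_le.2 (Set.ncard_le_ncard Set.inter_subset_left (graphBall_hexGrid_finite v i)))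
    (Nat.cast_nonneg _)

theorem playSurvivingRate_hexGrid_le_one (v : HexVertex) (P : ℕ → Finset HexVertex) :
    playSurvivingRate hexGrid v P ≤ 1 := by
  unfold playSurvivingRate
  refine (liminf_le_liminf (Eventually.of_forall (survivingRatio_le_one v P)) ?_ ?_).trans_eq
    (liminf_const (1 : ℝ))
  · exact isBoundedUnder_of ⟨0, fun i => by positivity⟩
  · exact isCoboundedUnder_ge_of_le atTop (x := 1) fun _ => le_rfl

theorem le_survivingRatio_wedgePlay {i : ℕ} (hi : 2 ≤ i) :
    1 - (1 / 3 : ℝ) * (1 + 2 * ((i / 2 : ℕ) : ℝ)⁻¹) ^ 2 ≤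
      ((graphBall hexGrid (0, 0, false) i ∩
        savedSet hexGrid (0, 0, false) wedgePlay).ncard : ℝ) /
          (graphBall hexGrid (0, 0, false) i).ncard := by
  have h1 := six_mul_sq_le_ncard_graphBall (i / 2) i (by omega)
  have h2 := ncard_graphBall_le_add_saved i
  have hm : 0 < i / 2 := by omega
  generalize (graphBall hexGrid (0, 0, false) i).ncard = B at *
  generalize (graphBall hexGrid (0, 0, false) i ∩ _).ncard = S at *
  generalize i / 2 = m at *
  have hm' : (0 : ℝ) < m := by exact_mod_cast hm
  have h1' : 6 * (m : ℝ) ^ 2 ≤ B := by exact_mod_cast h1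
  have h2' : (B : ℝ) ≤ S + 2 * (m + 2) ^ 2 := by exact_mod_cast h2
  have hB : (0 : ℝ) < B := lt_of_lt_of_le (by positivity) h1'
  rw [le_div_iff₀ hB]
  -- The error term is 2(m+2)² / (6m²), the bound for the burnt part over the bound for the ball.
  have h3 : (1 / 3 : ℝ) * (1 + 2 * (m : ℝ)⁻¹) ^ 2 * (6 * (m : ℝ) ^ 2) = 2 * (m + 2) ^ 2 := by
    field_simp
    ring
  have h4 := mul_le_mul_of_nonneg_left h1'
    (show 0 ≤ (1 / 3 : ℝ) * (1 + 2 * (m : ℝ)⁻¹) ^ 2 by positivity)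
  linarith

theorem two_thirds_le_playSurvivingRate_wedgePlay :
    2 / 3 ≤ playSurvivingRate hexGrid (0, 0, false) wedgePlay := by
  have hm : Tendsto (fun i : ℕ => ((i / 2 : ℕ) : ℝ)) atTop atTop :=
    tendsto_natCast_atTop_atTop.comp (Nat.tendsto_div_const_atTop two_ne_zero)
  have hlim : Tendsto (fun i : ℕ => 1 - (1 / 3 : ℝ) * (1 + 2 * ((i / 2 : ℕ) : ℝ)⁻¹) ^ 2) atTop
      (𝓝 (2 / 3)) := by
    have := (((hm.inv_tendsto_atTop.const_mul 2).const_add 1).pow 2).const_mul (1 / 3 : ℝ)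
      |>.const_sub 1
    convert this using 2 <;> norm_num
  rw [← hlim.liminf_eq]
  refine liminf_le_liminf ((eventually_ge_atTop 2).mono fun i hi =>
    le_survivingRatio_wedgePlay hi) hlim.isBoundedUnder_ge ?_
  exact isCoboundedUnder_ge_of_le atTop (x := 1) (survivingRatio_le_one _ _)

theorem theorem3 :
    (∀ v : HexVertex,
      2 / 3 ≤ survivingRate hexGrid v ∧
      ∃ P : ℕ → Finset HexVertex,
        IsLegal hexGrid v (fun _ => 1) P ∧ 2 / 3 ≤ playSurvivingRate hexGrid v P) ∧
    (∀ v : HexVertex, ∃ σ : OnlineStrategy HexVertex,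
      ∀ t₁ t₂ : ℕ, 1 ≤ t₁ → t₁ ≤ t₂ →
        IsLegal hexGrid v (extraAllowance t₁ t₂) (σ.play (extraAllowance t₁ t₂)) ∧
        IsContained hexGrid v (σ.play (extraAllowance t₁ t₂))) := by
  constructor
  · intro v
    have hP : ∃ P : ℕ → Finset HexVertex,
        IsLegal hexGrid v (fun _ => 1) P ∧ 2 / 3 ≤ playSurvivingRate hexGrid v P := by
      obtain ⟨e, rfl⟩ := exists_hexGrid_iso v
      refine ⟨mapPlay e wedgePlay, isLegal_wedgePlay.mapPlay e, ?_⟩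
      rw [playSurvivingRate_mapPlay]
      exact two_thirds_le_playSurvivingRate_wedgePlay
    refine ⟨?_, hP⟩
    obtain ⟨P, hlegal, hrate⟩ := hP
    -- The real supremum of an unbounded set is 0 by default, so the bound 1 on all rates is needed.
    refine hrate.trans (le_csSup ⟨1, ?_⟩ ⟨P, hlegal, rfl⟩)
    rintro _ ⟨P, -, rfl⟩
    exact playSurvivingRate_hexGrid_le_one v P
  · intro v
    obtain ⟨e, rfl⟩ := exists_hexGrid_iso v
    refine ⟨fun l => (containingStrategy l).map e.toEquiv.toEmbedding, fun t₁ t₂ h₁ h₂ => ?_⟩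
    have hplay : OnlineStrategy.play (fun l => (containingStrategy l).map e.toEquiv.toEmbedding)
        (extraAllowance t₁ t₂) = mapPlay e (containingPlay t₁) := by
      rw [← containingStrategy_play h₁ h₂]
      rfl
    rw [hplay]
    exact ⟨(isLegal_containingPlay h₁ t₂).mapPlay e, (isContained_containingPlay h₁).mapPlay e⟩
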